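/- **Setting.** Let $d\in\{1,2,3\}$, let $\Omega\subset\mathbb R^d$ be a bounded polyhedral domain (open, connected, $\Omega=\operatorname{int}\overline\Omega$, and $\overline\Omega$ a finite union of convex polytopes), and let $\mathcal T_h$ be a conforming partition of $\overline\Omega$ into nondegenerate closed simplices, with node set $\mathcal N_h$ and mesh size $h=\max_{T\in\mathcal T_h}\operatorname{diam}T$. For $\kappa>0$, call $\mathcal T_h$ $\kappa$-quasiuniform if every $T\in\mathcal T_h$ contains a ball of radius $\kappa h$. Let $V_h$ be the space of continuous functions $\overline\Omega\to\mathbb R$ that are affine on each $T\in\mathcal T_h$, $\mathbf V_h=[V_h]^3$, $\{\varphi_{\mathbf z}\}_{\mathbf z\in\mathcal N_h}$ the nodal basis of $V_h$, $\mathcal I_h w=\sum_{\mathbf z}w(\mathbf z)\varphi_{\mathbf z}$, $\beta_{\mathbf z}=\int_\Omega\varphi_{\mathbf z}$, $(\mathbf v,\mathbf w)_h=\int_\Omega\mathcal I_h\langle\mathbf v,\mathbf w\rangle\,dx$, and let $(\cdot,\cdot)$ be the $L^2(\Omega)$ inner product. For a time step $\tau>0$ write $d_t\psi^n=\tau^{-1}(\psi^n-\psi^{n-1})$,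 $\psi^{n+1/2}=\frac12(\psi^{n+1}+\psi^n)$, $d_t\psi^{n+1/2}=\tau^{-1}(\psi^{n+1/2}-\psi^{n-1/2})$, $d_t^2\psi^{n+1}=\tau^{-1}(d_t\psi^{n+1}-d_t\psi^n)$. For $n\ge0$ and given $\mathbf U^{n-1},\mathbf U^n,\mathbf W^n\in\mathbf V_h$, the nonlinear system for $\mathbf U^{n+1},\mathbf W^{n+1}\in\mathbf V_h$ is $$ \begin{aligned} (d_t^2\mathbf U^{n+1},\mathbf\Phi)_h+(\nabla\mathbf W^{n+1/2},\nabla\mathbf\Phi)&=(\lambda_w^{n+1}\mathbf U^{n+1/2},\mathbf\Phi)_h &&\forall\,\mathbf\Phi\in\mathbf V_h,\\ (\mathbf W^{n+1/2},\mathbf\Psi)_h&=(\nabla\mathbf U^{n+1/2},\nabla\mathbf\Psi)&&\forall\,\mathbf\Psi\in\mathbf V_h, \end{aligned} \tag{S} $$ where $\lambda_w^{n+1}\in V_h$ is the discrete Lagrange multiplier with nodal values $\lambda_w^{n+1}(\mathbf z)=0$ if $\mathbf U^{n+1/2}(\mathbf z)=0$, and otherwise $$ \lambda_w^{n+1}(\mathbf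 z)=-\frac{\mu^{n+1}(\mathbf z)}{|\mathbf U^{n+1/2}(\mathbf z)|^2}+\frac{(\nabla\mathbf W^{n+1/2},\mathbf U^{n+1/2}(\mathbf z)\otimes\nabla\varphi_{\mathbf z})}{\beta_{\mathbf z}|\mathbf U^{n+1/2}(\mathbf z)|^2}, $$ with $\mu^{n+1}=\langle d_t\mathbf U^n,d_t\mathbf U^{n+1/2}\rangle$ for $n\ge1$ and $\mu^1=\frac12\langle d_t\mathbf U^0,d_t\mathbf U^1\rangle$ for $n=0$. **Lemma.** For every $d\in\{1,2,3\}$ and $\kappa>0$ there is a constant $C>0$, depending only on $d$ and $\kappa$, such that for every $\Omega$ and every $\kappa$-quasiuniform $\mathcal T_h$ as above, every $n\ge0$, and every $\tau$ with $0<\tau\le Ch^2$, the following holds. Let $\mathbf W^n\in\mathbf V_h$ be arbitrary (in the numerical scheme it comes from the previous step) and let $\mathbf U^{n},\mathbf U^{n-1}\in\mathbf V_h$ satisfy $|\mathbf U^n(\mathbf z)|=1$ for all $\mathbf z\in\mathcal N_h$ and, moreover, - if $n\ge1$: $|\mathbf U^{n-1}(\mathbf z)|=1$ for all $\mathbf z\in\mathcal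 N_h$; - if $n=0$: $\mathbf U^{-1}=\mathbf U^0-\tau\mathbf V^0$ for some $\mathbf V^0\in\mathbf V_h$ with $\langle\mathbf U^0(\mathbf z),\mathbf V^0(\mathbf z)\rangle=0$ for all $\mathbf z\in\mathcal N_h$. Then there exist $\mathbf U^{n+1},\mathbf W^{n+1}\in\mathbf V_h$ that satisfy (S). -/

import Mathlib

open MeasureTheory
open scoped InnerProductSpace

namespace BiharmonicWave

/-- The space `ℝᵈ` containing the spatial domain. -/
abbrev Space (d : ℕ) : Type := EuclideanSpace ℝ (Fin d)

/-- The space `ℝ³` containing the target sphere. -/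
abbrev R3 : Type := EuclideanSpace ℝ (Fin 3)

/-- Bounded polyhedral domains: open, connected, bounded, with closure a finite union of convex
polytopes, and lying locally on one side of the boundary (no slits or removed lower-dimensional
pieces). Convexity is not required. -/
structure IsPolyhedralDomain {d : ℕ} (Ω : Set (Space d)) : Prop where
  isOpen : IsOpen Ω
  isConnected : IsConnected Ω
  isBounded : Bornology.IsBounded Ω
  interior_closure : interior (closure Ω) = Ω
  polyhedral : ∃ P : Finset (Finset (Space d)),
    closure Ω = ⋃ p ∈ P, convexHull ℝ (p : Set (Space d))

/-- A (conforming) simplicial partition of `Ω`: a finite geometric simplicial complex, all of whose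
faces are faces of `d`-dimensional simplices, which covers exactly `closure Ω`. -/
structure Triangulation {d : ℕ} (Ω : Set (Space d)) extends
    Geometry.SimplicialComplex ℝ (Space d) where
  finite_faces : faces.Finite
  pure : ∀ s ∈ faces, ∃ T ∈ faces, s ⊆ T ∧ T.card = d + 1
  space_eq : toSimplicialComplex.space = closure Ω

namespace Triangulation

variable {d : ℕ} {Ω : Set (Space d)} (K : Triangulation Ω)

/-- The elements of the partition, each given by its set of `d + 1` vertices; as a subset of `ℝᵈ`,
the element `T` is the closed simplex `convexHull ℝ T`. -/
def elements : Set (Finset (Space d)) := {T | T ∈ K.faces ∧ T.card = d + 1}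

theorem finite_vertices : K.vertices.Finite := by
  rw [K.toSimplicialComplex.vertices_eq]
  exact K.finite_faces.biUnion fun s _ => s.finite_toSet

/-- The nodes: the vertices of all the elements. -/
noncomputable def nodes : Finset (Space d) := K.finite_vertices.toFinset

/-- The mesh size `h = max_T diam T`. -/
noncomputable def meshSize : ℝ :=
  ⨆ T : K.elements, Metric.diam (convexHull ℝ ((T : Finset (Space d)) : Set (Space d)))

/-- Quasiuniformity with constant `κ`: every element contains a ball of radius `κ h`. A family of
partitions is quasiuniform if one `κ > 0` serves all its members. -/
def QuasiUniform (κ : ℝ) : Prop :=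
  ∀ T ∈ K.elements, ∃ x : Space d,
    Metric.closedBall x (κ * K.meshSize) ⊆ convexHull ℝ (T : Set (Space d))

/-- The lowest order conforming finite element space of `F`-valued functions: functions that are
continuous on `closure Ω` and affine on each element. Functions on `closure Ω` are represented by
their extensions by zero, so that equality in this space is equality on `closure Ω`.
`V_h` is the case `F = ℝ`, and `𝐕_h` is the case `F = ℝ³`. -/
def feSpace (F : Type) [NormedAddCommGroup F] [NormedSpace ℝ F] :
    Submodule ℝ (Space d → F) where
  carrier := {v | ContinuousOn v (closure Ω) ∧
    (∀ T ∈ K.elements, ∃ A : Space d →ᵃ[ℝ] F,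
      Set.EqOn v A (convexHull ℝ (T : Set (Space d)))) ∧
    ∀ x, x ∉ closure Ω → v x = 0}
  add_mem' := by
    rintro v w ⟨hv, hvA, hv0⟩ ⟨hw, hwA, hw0⟩
    refine ⟨hv.add hw, fun T hT => ?_, fun x hx => by simp [hv0 x hx, hw0 x hx]⟩
    obtain ⟨A, hA⟩ := hvA T hT
    obtain ⟨B, hB⟩ := hwA T hT
    exact ⟨A + B, fun x hx => by simp [hA hx, hB hx]⟩
  zero_mem' := ⟨continuousOn_const, fun _ _ => ⟨0, fun _ _ => by simp⟩, fun _ _ => rfl⟩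
  smul_mem' := by
    rintro c v ⟨hv, hvA, hv0⟩
    refine ⟨hv.const_smul c, fun T hT => ?_, fun x hx => by simp [hv0 x hx]⟩
    obtain ⟨A, hA⟩ := hvA T hT
    exact ⟨c • A, fun x hx => by simp [hA hx]⟩

/-- `w` is the family of barycentric coordinates of `x` with respect to the vertices of some face
of the partition, extended by `0` to all other points. -/
def IsBarycentric (x : Space d) (w : Space d → ℝ) : Prop :=
  ∃ s ∈ K.faces, (∀ y ∈ s, 0 ≤ w y) ∧ (∀ y, y ∉ s → w y = 0) ∧
    ∑ y ∈ s, w y = 1 ∧ ∑ y ∈ s, w y • y = x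

open Classical in
/-- The nodal basis function `φ_z`: on each element its value at `x` is the barycentric coordinate
of `x` belonging to the vertex `z` (and `0` if `z` is not a vertex of the element). -/
noncomputable def hat (z x : Space d) : ℝ :=
  if h : ∃ w, K.IsBarycentric x w then h.choose z else 0

/-- The nodal interpolation `I_h g = ∑_z g(z) φ_z`. -/
noncomputable def interp (g : Space d → ℝ) (x : Space d) : ℝ :=
  ∑ z ∈ K.nodes, g z * K.hat z x

/-- The weight `β_z = ∫_Ω φ_z`. -/
noncomputable def beta (z : Space d) : ℝ := ∫ x in Ω, K.hat z x

/-- The discrete inner product `(v, w)_h = ∫_Ω I_h ⟨v, w⟩`. -/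
noncomputable def discInner (v w : Space d → R3) : ℝ :=
  ∫ x in Ω, K.interp (fun y => ⟪v y, w y⟫_ℝ) x

end Triangulation

/-- `(∇v, ∇w) = ∫_Ω ∑ᵢ ⟨∂ᵢ v, ∂ᵢ w⟩`. For piecewise affine functions the derivatives exist almost
everywhere and are the weak derivatives. -/
noncomputable def gradInner {d : ℕ} (Ω : Set (Space d)) (v w : Space d → R3) : ℝ :=
  ∫ x in Ω, ∑ i : Fin d,
    ⟪fderiv ℝ v x (EuclideanSpace.single i 1), fderiv ℝ w x (EuclideanSpace.single i 1)⟫_ℝ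

/-- The backward difference quotient `d_t ψ = τ⁻¹ (ψ - ψ')`, with `ψ'` the preceding value. -/
noncomputable def dt {X : Type} [AddCommGroup X] [Module ℝ X] (τ : ℝ) (ψ' ψ : X) : X :=
  τ⁻¹ • (ψ - ψ')

/-- The average `(ψ + ψ') / 2` of two consecutive values. -/
noncomputable def avg {X : Type} [AddCommGroup X] [Module ℝ X] (ψ' ψ : X) : X :=
  (1 / 2 : ℝ) • (ψ + ψ')

namespace Triangulation

variable {d : ℕ} {Ω : Set (Space d)} (K : Triangulation Ω)

open Classical in
/-- The nodal values of the discrete Lagrange multiplier `λ_w^{n+1}`, where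
`Uprev, U, Unext = U^{n-1}, U^n, U^{n+1}` and `W, Wnext = W^n, W^{n+1}`.
Here `d_t U^{n+1/2} = τ⁻¹ (U^{n+1/2} - U^{n-1/2})`; for `n = 0` the difference quotients
`V⁰ = d_t U⁰`, `V¹ = d_t U¹` are taken with `U^{-1} = U⁰ - τ V⁰`. The product
`(∇W, u(z) ⊗ ∇φ_z)` is `(∇W, ∇(φ_z u(z)))` with the constant vector `u(z)`. -/
noncomputable def multiplierValue (n : ℕ) (τ : ℝ) (Uprev U Unext W Wnext : Space d → R3)
    (z : Space d) : ℝ :=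
  let u := avg U Unext z
  if u = 0 then 0
  else if n = 0 then
    -((1 / 2) * ⟪dt τ Uprev U z, dt τ U Unext z⟫_ℝ) / ‖u‖ ^ 2
      + gradInner Ω (avg W Wnext) (fun x => K.hat z x • u) / (K.beta z * ‖u‖ ^ 2)
  else
    -⟪dt τ Uprev U z, dt τ (avg Uprev U) (avg U Unext) z⟫_ℝ / ‖u‖ ^ 2
      + gradInner Ω (avg W Wnext) (fun x => K.hat z x • u) / (K.beta z * ‖u‖ ^ 2)

/-- The discrete Lagrange multiplier `λ_w^{n+1} ∈ V_h`. -/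
noncomputable def multiplier (n : ℕ) (τ : ℝ) (Uprev U Unext W Wnext : Space d → R3) :
    Space d → ℝ :=
  K.interp (K.multiplierValue n τ Uprev U Unext W Wnext)

/-- `(U^{n+1}, W^{n+1}) = (Unext, Wnext)` solves the nonlinear system of the time step `n → n + 1`
with data `U^{n-1}, U^n, W^n = Uprev, U, W`. -/
structure SolvesStep (n : ℕ) (τ : ℝ) (Uprev U W Unext Wnext : Space d → R3) : Prop where
  memU : Unext ∈ K.feSpace R3
  memW : Wnext ∈ K.feSpace R3
  wave : ∀ Φ ∈ K.feSpace R3,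
    K.discInner (dt τ (dt τ Uprev U) (dt τ U Unext)) Φ + gradInner Ω (avg W Wnext) Φ
      = K.discInner
          (fun x => K.multiplier n τ Uprev U Unext W Wnext x • avg U Unext x) Φ
  laplace : ∀ Ψ ∈ K.feSpace R3,
    K.discInner (avg W Wnext) Ψ = gradInner Ω (avg U Unext) Ψ

/-- The data `U^{n-1}, U^n ∈ 𝐕_h` of the time step: the sphere constraint holds at the nodes and,
for `n = 0`, `U^{-1} = U⁰ - τ V⁰` with `V⁰ ∈ 𝐕_h` orthogonal to `U⁰` at the nodes. -/
structure AdmissibleData (n : ℕ) (τ : ℝ) (Uprev U : Space d → R3) : Prop where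
  mem_prev : Uprev ∈ K.feSpace R3
  mem : U ∈ K.feSpace R3
  norm_eq : ∀ z ∈ K.nodes, ‖U z‖ = 1
  norm_prev : n ≠ 0 → ∀ z ∈ K.nodes, ‖Uprev z‖ = 1
  initial : n = 0 → ∃ V₀ ∈ K.feSpace R3,
    (∀ z ∈ K.nodes, ⟪U z, V₀ z⟫_ℝ = 0) ∧ Uprev = U - τ • V₀

end Triangulation

end BiharmonicWave

namespace BiharmonicWave

/-! Mass lumping makes (S) nodewise. Let `L` be the discrete negative Laplacian on nodal values, and
take the midpoints u = U^{n+1/2}, w = W^{n+1/2} as unknowns. The second equation says w = L u. With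
U^{n+1} = 2u - U^n the first becomes 2u - q = τ² λ u, where q = 3U^n - U^{n-1} - τ² L² u. So u must
be parallel to q, and a solution is sought with |2u - U^n| = 1, that is, |u|² = ⟨U^n, u⟩. This makes
u the orthogonal projection of U^n onto the line through q: a fixed point equation (`lineProj`).

The equation is solved by contraction on the unit ball of the nodal maximum norm. The admissible
data give ⟨U^n, 3U^n - U^{n-1}⟩ ≥ 2, so q stays outside the open unit ball, where projection onto
the line of q is Lipschitz in q with constant 2 (`norm_lineProj_sub_le`). The inverse estimate
`HasInballs.sum_abs_stiff_le` bounds `L` by a multiple of h⁻², so τ ≤ C h² gives ‖τ² L²‖ ≤ 1/4 and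
the map contracts by 1/2 (`exists_lineProj_fixedPoint`).

Conversely, at a fixed point the residual is a multiple of u; pairing with u identifies the factor
with the prescribed multiplier (`residual_eq_smul`), the terms μ being rewritten through the
constraints on U^n and U^{n-1}. -/

theorem affineMap_map_sum_smul {E F : Type*} [AddCommGroup E] [Module ℝ E] [AddCommGroup F]
    [Module ℝ F] (A : E →ᵃ[ℝ] F) (s : Finset E) (w : E → ℝ) (hw : ∑ y ∈ s, w y = 1) :
    A (∑ y ∈ s, w y • y) = ∑ y ∈ s, w y • A y := by
  have h : ∀ x, A x = A.linear x + A 0 := fun x => by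
    rw [← vadd_eq_add, ← A.map_vadd]; simp
  rw [h, map_sum]
  have h2 : ∀ y ∈ s, w y • A y = A.linear (w y • y) + w y • A 0 := fun y _ => by
    rw [h y, smul_add, map_smul]
  rw [Finset.sum_congr rfl h2, Finset.sum_add_distrib, ← Finset.sum_smul, hw, one_smul]

/-! ### Barycentric coordinates and the nodal basis -/

namespace Triangulation

variable {d : ℕ} {Ω : Set (Space d)} (K : Triangulation Ω)

theorem mem_nodes {z : Space d} : z ∈ K.nodes ↔ ({z} : Finset (Space d)) ∈ K.faces := by
  simp [nodes, Geometry.SimplicialComplex.vertices]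

theorem mem_nodes_of_mem_face {s : Finset (Space d)} (hs : s ∈ K.faces) {z : Space d}
    (hz : z ∈ s) : z ∈ K.nodes :=
  K.mem_nodes.2 (K.down_closed hs (by simpa using hz) (by simp))

theorem exists_element {z : Space d} (hz : z ∈ K.nodes) : ∃ T ∈ K.elements, z ∈ T := by
  obtain ⟨T, hT, hsub, hc⟩ := K.pure _ (K.mem_nodes.1 hz)
  exact ⟨T, ⟨hT, hc⟩, by simpa using hsub⟩

theorem finite_elements : K.elements.Finite := K.finite_faces.subset fun _ h => h.1

theorem closure_eq : closure Ω = ⋃ T ∈ K.elements, convexHull ℝ (T : Set (Space d)) := by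
  rw [← K.space_eq]
  apply Set.Subset.antisymm
  · intro x hx
    obtain ⟨s, hs, hx⟩ := Geometry.SimplicialComplex.mem_space_iff.1 hx
    obtain ⟨T, hT, hsub, hc⟩ := K.pure s hs
    exact Set.mem_biUnion (show T ∈ K.elements from ⟨hT, hc⟩)
      (convexHull_mono (by exact_mod_cast hsub) hx)
  · exact Set.iUnion₂_subset fun T hT =>
      Geometry.SimplicialComplex.convexHull_subset_space hT.1

theorem convexHull_subset_closure {T : Finset (Space d)} (hT : T ∈ K.elements) :
    convexHull ℝ (T : Set (Space d)) ⊆ closure Ω := by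
  rw [K.closure_eq]
  exact Set.subset_biUnion_of_mem
    (u := fun T : Finset (Space d) => convexHull ℝ (T : Set (Space d))) hT

theorem exists_element_of_mem_closure {x : Space d} (hx : x ∈ closure Ω) :
    ∃ T ∈ K.elements, x ∈ convexHull ℝ (T : Set (Space d)) := by
  simpa [K.closure_eq] using hx

theorem weights_unique {s : Finset (Space d)} (hs : s ∈ K.faces) {w w' : Space d → ℝ}
    (hw : ∑ y ∈ s, w y = 1) (hw' : ∑ y ∈ s, w' y = 1)
    (h : ∑ y ∈ s, w y • y = ∑ y ∈ s, w' y • y) : ∀ y ∈ s, w y = w' y := by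
  have hi := affineIndependent_iff.1 (K.indep hs) Finset.univ (fun y => w y - w' y)
    (by
      rw [Finset.sum_coe_sort s (fun y => w y - w' y), Finset.sum_sub_distrib, hw, hw', sub_self])
    (by
      rw [Finset.sum_coe_sort s (fun y => (w y - w' y) • y)]
      simp only [sub_smul, Finset.sum_sub_distrib, h, sub_self])
  intro y hy
  exact sub_eq_zero.1 (hi ⟨y, hy⟩ (Finset.mem_univ _))

theorem weights_eq_of_subset {s t : Finset (Space d)} (hs : s ∈ K.faces) (hts : t ⊆ s)
    {w w' : Space d → ℝ} {x : Space d}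
    (hw0 : ∀ y, y ∉ s → w y = 0) (hw : ∑ y ∈ s, w y = 1) (hwx : ∑ y ∈ s, w y • y = x)
    (hw0' : ∀ y, y ∉ t → w' y = 0) (hw' : ∑ y ∈ t, w' y = 1) (hwx' : ∑ y ∈ t, w' y • y = x) :
    w = w' := by
  have h1 : ∑ y ∈ s, w' y = 1 := by
    rw [← hw', Finset.sum_subset hts fun y _ hy => hw0' y hy]
  have h2 : ∑ y ∈ s, w' y • y = x := by
    rw [← hwx', Finset.sum_subset hts fun y _ hy => by rw [hw0' y hy, zero_smul]]
  funext y
  by_cases hy : y ∈ s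
  · exact K.weights_unique hs hw h1 (hwx.trans h2.symm) y hy
  · rw [hw0 y hy, hw0' y fun h => hy (hts h)]

theorem exists_weights {s : Finset (Space d)} {x : Space d}
    (hx : x ∈ convexHull ℝ (s : Set (Space d))) :
    ∃ w : Space d → ℝ, (∀ y ∈ s, 0 ≤ w y) ∧ (∀ y, y ∉ s → w y = 0) ∧
      ∑ y ∈ s, w y = 1 ∧ ∑ y ∈ s, w y • y = x := by
  classical
  obtain ⟨w, h0, h1, h2⟩ := Finset.mem_convexHull'.1 hx
  refine ⟨fun y => if y ∈ s then w y else 0, fun y hy => ?_, fun y hy => by simp [hy], ?_, ?_⟩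
  · simpa [hy] using h0 y hy
  · rw [← h1]; exact Finset.sum_congr rfl fun y hy => by simp [hy]
  · rw [← h2]; exact Finset.sum_congr rfl fun y hy => by simp [hy]

variable {K} in
-- This is where conformity enters: two faces containing `x` meet inside the hull of their common
-- vertices, so both families agree with the weights of `x` on those vertices, extended by zero.
-- Hence `hat` does not depend on the chosen face.
theorem IsBarycentric.unique {x : Space d} {w w' : Space d → ℝ} (h : K.IsBarycentric x w)
    (h' : K.IsBarycentric x w') : w = w' := by
  classical
  obtain ⟨s, hs, hp, h0, h1, hx⟩ := h
  obtain ⟨t, ht, hp', h0', h1', hx'⟩ := h'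
  have hxs : x ∈ convexHull ℝ (s : Set (Space d)) :=
    Finset.mem_convexHull'.2 ⟨w, hp, h1, hx⟩
  have hxt : x ∈ convexHull ℝ (t : Set (Space d)) :=
    Finset.mem_convexHull'.2 ⟨w', hp', h1', hx'⟩
  have hxi := K.inter_subset_convexHull hs ht ⟨hxs, hxt⟩
  rw [← Finset.coe_inter] at hxi
  obtain ⟨v, -, h0v, h1v, hxv⟩ := exists_weights hxi
  rw [K.weights_eq_of_subset hs Finset.inter_subset_left h0 h1 hx h0v h1v hxv,
    K.weights_eq_of_subset ht Finset.inter_subset_right h0' h1' hx' h0v h1v hxv]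

variable {K} in
theorem IsBarycentric.hat_eq {x : Space d} {w : Space d → ℝ} (h : K.IsBarycentric x w)
    (z : Space d) : K.hat z x = w z := by
  have hex : ∃ w, K.IsBarycentric x w := ⟨w, h⟩
  rw [hat, dif_pos hex, hex.choose_spec.unique h]

theorem hat_eq_zero_of_notMem {x : Space d} (hx : x ∉ closure Ω) (z : Space d) :
    K.hat z x = 0 := by
  rw [hat, dif_neg]
  rintro ⟨w, s, hs, hp, h0, h1, hxs⟩
  apply hx
  rw [← K.space_eq]
  exact Geometry.SimplicialComplex.convexHull_subset_space hs
    (Finset.mem_convexHull'.2 ⟨w, hp, h1, hxs⟩)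

open Classical in
theorem hat_node {z z' : Space d} (hz' : z' ∈ K.nodes) :
    K.hat z z' = if z = z' then 1 else 0 := by
  have h : K.IsBarycentric z' (fun y => if y = z' then 1 else 0) := by
    refine ⟨{z'}, K.mem_nodes.1 hz', ?_, ?_, ?_, ?_⟩ <;> simp
  exact h.hat_eq z

/-- On a face, the values of the nodal basis functions are barycentric coordinates. -/
theorem hat_weights {s : Finset (Space d)} (hs : s ∈ K.faces) {x : Space d}
    (hx : x ∈ convexHull ℝ (s : Set (Space d))) :
    (∀ z, 0 ≤ K.hat z x) ∧ (∀ z, z ∉ s → K.hat z x = 0) ∧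
      ∑ y ∈ s, K.hat y x = 1 ∧ ∑ y ∈ s, K.hat y x • y = x := by
  obtain ⟨w, hp, h0, h1, hxs⟩ := exists_weights hx
  have h := IsBarycentric.hat_eq (K := K) ⟨s, hs, hp, h0, h1, hxs⟩
  simp only [h]
  refine ⟨fun z => ?_, h0, h1, hxs⟩
  by_cases hz : z ∈ s
  exacts [hp z hz, (h0 z hz).ge]

theorem hat_nonneg (z x : Space d) : 0 ≤ K.hat z x := by
  by_cases hx : x ∈ closure Ω
  · obtain ⟨T, hT, hxT⟩ := K.exists_element_of_mem_closure hx
    exact (K.hat_weights hT.1 hxT).1 z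
  · exact (K.hat_eq_zero_of_notMem hx z).ge

theorem hat_le_one (z x : Space d) : K.hat z x ≤ 1 := by
  by_cases hx : x ∈ closure Ω
  · obtain ⟨T, hT, hxT⟩ := K.exists_element_of_mem_closure hx
    obtain ⟨h0, hz, h1, -⟩ := K.hat_weights hT.1 hxT
    by_cases hzT : z ∈ T
    · rw [← h1]
      exact Finset.single_le_sum (f := fun y => K.hat y x) (fun y _ => h0 y) hzT
    · rw [hz z hzT]; exact zero_le_one
  · rw [K.hat_eq_zero_of_notMem hx z]; exact zero_le_one

open Classical in
-- The `d + 1` affinely independent vertices form an affine basis, whose coordinates are the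
-- required maps. The clause for `z ∉ T` later makes gradients local.
theorem exists_affine_coord {T : Finset (Space d)} (hT : T ∈ K.elements) (z : Space d) :
    ∃ A : Space d →ᵃ[ℝ] ℝ, (z ∉ T → A = 0) ∧ ∀ y ∈ T, A y = if z = y then 1 else 0 := by
  by_cases hz : z ∈ T
  · have hind := K.indep hT.1
    have htop := hind.affineSpan_eq_top_iff_card_eq_finrank_add_one.2 (by simp [hT.2])
    let b : AffineBasis T ℝ (Space d) := ⟨_, hind, htop⟩
    refine ⟨b.coord ⟨z, hz⟩, fun h => absurd hz h, fun y hy => ?_⟩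
    exact (b.coord_apply ⟨z, hz⟩ ⟨y, hy⟩).trans (by simp)
  · refine ⟨0, fun _ => rfl, fun y hy => ?_⟩
    rw [if_neg (fun h : z = y => hz (by rwa [h]))]; rfl

/-- On each element, the nodal basis functions are affine. -/
theorem exists_hat_eqOn {T : Finset (Space d)} (hT : T ∈ K.elements) (z : Space d) :
    ∃ A : Space d →ᵃ[ℝ] ℝ, (z ∉ T → A = 0) ∧
      Set.EqOn (K.hat z) A (convexHull ℝ (T : Set (Space d))) := by
  classical
  obtain ⟨A, hA0, hA⟩ := K.exists_affine_coord hT z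
  refine ⟨A, hA0, fun x hx => ?_⟩
  obtain ⟨-, h0, h1, hxs⟩ := K.hat_weights hT.1 hx
  conv_rhs => rw [← hxs]
  rw [affineMap_map_sum_smul A T _ h1, Finset.sum_congr rfl fun y hy => by rw [hA y hy]]
  by_cases hz : z ∈ T
  · simp [hz]
  · simp [hz, h0 z hz]

theorem isClosed_hull (T : Finset (Space d)) : IsClosed (convexHull ℝ (T : Set (Space d))) :=
  (T.finite_toSet.isCompact_convexHull ℝ).isClosed

theorem continuousOn_hat (z : Space d) : ContinuousOn (K.hat z) (closure Ω) := by
  have := K.finite_elements.to_subtype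
  rw [K.closure_eq, Set.biUnion_eq_iUnion]
  refine (locallyFinite_of_finite _).continuousOn_iUnion (fun T => isClosed_hull _) fun T => ?_
  obtain ⟨A, -, hA⟩ := K.exists_hat_eqOn T.2 z
  exact A.continuous_of_finiteDimensional.continuousOn.congr hA

theorem hat_smul_mem_feSpace {F : Type} [NormedAddCommGroup F] [NormedSpace ℝ F] (z : Space d)
    (u : F) : (fun x => K.hat z x • u) ∈ K.feSpace F := by
  refine ⟨(K.continuousOn_hat z).smul continuousOn_const, fun T hT => ?_, fun x hx => ?_⟩
  · obtain ⟨A, -, hA⟩ := K.exists_hat_eqOn hT z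
    refine ⟨((LinearMap.toSpanSingleton ℝ F u).toAffineMap).comp A, fun x hx => ?_⟩
    simp [hA hx]
  · simp [K.hat_eq_zero_of_notMem hx z]

/-- A finite element function is determined by its nodal values. -/
theorem eq_sum_hat {F : Type} [NormedAddCommGroup F] [NormedSpace ℝ F] {v : Space d → F}
    (hv : v ∈ K.feSpace F) : v = fun x => ∑ z ∈ K.nodes, K.hat z x • v z := by
  funext x
  by_cases hx : x ∈ closure Ω
  · obtain ⟨T, hT, hxT⟩ := K.exists_element_of_mem_closure hx
    obtain ⟨B, hB⟩ := hv.2.1 T hT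
    obtain ⟨-, h0, h1, hxs⟩ := K.hat_weights hT.1 hxT
    rw [← Finset.sum_subset (fun y hy => K.mem_nodes_of_mem_face hT.1 hy)
      (fun y _ hy => by rw [h0 y hy, zero_smul]), hB hxT]
    conv_lhs => rw [← hxs]
    rw [affineMap_map_sum_smul B T _ h1]
    exact Finset.sum_congr rfl fun y hy => by
      rw [hB (subset_convexHull ℝ _ (by exact_mod_cast hy))]
  · rw [hv.2.2 x hx]
    exact (Finset.sum_eq_zero fun z _ => by rw [K.hat_eq_zero_of_notMem hx, zero_smul]).symm

/-- The finite element function with given nodal values. -/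
noncomputable def nodal {F : Type} [NormedAddCommGroup F] [NormedSpace ℝ F] (g : Space d → F)
    (x : Space d) : F :=
  ∑ z ∈ K.nodes, K.hat z x • g z

theorem nodal_mem {F : Type} [NormedAddCommGroup F] [NormedSpace ℝ F] (g : Space d → F) :
    K.nodal g ∈ K.feSpace F := by
  have : K.nodal g = ∑ z ∈ K.nodes, fun x => K.hat z x • g z := by
    funext x; simp [nodal]
  rw [this]
  exact Submodule.sum_mem _ fun z _ => K.hat_smul_mem_feSpace z _

theorem nodal_node {F : Type} [NormedAddCommGroup F] [NormedSpace ℝ F] (g : Space d → F)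
    {z : Space d} (hz : z ∈ K.nodes) : K.nodal g z = g z := by
  classical
  have h : ∀ y ∈ K.nodes, K.hat y z • g y = if y = z then g y else 0 := fun y _ => by
    rw [K.hat_node hz, ite_smul, one_smul, zero_smul]
  rw [nodal, Finset.sum_congr rfl h]
  simp [hz]

theorem interp_node (g : Space d → ℝ) {z : Space d} (hz : z ∈ K.nodes) :
    K.interp g z = g z := by
  rw [← K.nodal_node g hz]
  simp [nodal, interp, mul_comm]

end Triangulation

/-! ### Gradients of the nodal basis, lumped mass and stiffness matrix -/

namespace Triangulation

variable {d : ℕ} {Ω : Set (Space d)} (K : Triangulation Ω)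

theorem ae_notMem_frontier :
    ∀ᵐ x : Space d, ∀ T ∈ K.elements, x ∉ frontier (convexHull ℝ (T : Set (Space d))) := by
  rw [ae_ball_iff K.finite_elements.countable]
  intro T _
  exact measure_eq_zero_iff_ae_notMem.1 ((convex_convexHull ℝ _).addHaar_frontier volume)

theorem ae_mem_interior (hΩ : IsPolyhedralDomain Ω) :
    ∀ᵐ x ∂volume.restrict Ω, ∃ T ∈ K.elements,
      x ∈ interior (convexHull ℝ (T : Set (Space d))) := by
  rw [ae_restrict_iff' hΩ.isOpen.measurableSet]
  filter_upwards [K.ae_notMem_frontier] with x hx hxΩ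
  obtain ⟨T, hT, hxT⟩ := K.exists_element_of_mem_closure (subset_closure hxΩ)
  refine ⟨T, hT, ?_⟩
  by_contra h
  exact hx T hT ⟨subset_closure hxT, h⟩

/-- Off the null frontiers of the finitely many convex elements, a point of the closure is interior
to an element, hence lies in `interior (closure Ω) = Ω`. -/
theorem restrict_closure_eq (K : Triangulation Ω) (hΩ : IsPolyhedralDomain Ω) :
    (volume : Measure (Space d)).restrict (closure Ω) = volume.restrict Ω := by
  refine Measure.restrict_congr_set ?_
  filter_upwards [K.ae_notMem_frontier] with x hx
  refine propext ⟨fun h => ?_, fun h => subset_closure h⟩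
  obtain ⟨T, hT, hxT⟩ := K.exists_element_of_mem_closure h
  have hi : x ∈ interior (convexHull ℝ (T : Set (Space d))) := by
    by_contra h
    exact hx T hT ⟨subset_closure hxT, h⟩
  have := interior_mono (K.convexHull_subset_closure hT) hi
  rwa [hΩ.interior_closure] at this

/-- The partial derivatives of the nodal basis functions. -/
noncomputable def dhat (z : Space d) (i : Fin d) (x : Space d) : ℝ :=
  fderiv ℝ (K.hat z) x (EuclideanSpace.single i 1)

theorem measurable_dhat (z : Space d) (i : Fin d) : Measurable (K.dhat z i) :=
  measurable_fderiv_apply_const ℝ (K.hat z) _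

theorem exists_hasFDerivAt_hat {T : Finset (Space d)} (hT : T ∈ K.elements) (z : Space d) :
    ∃ A : Space d →ᵃ[ℝ] ℝ, (z ∉ T → A = 0) ∧
      Set.EqOn (K.hat z) A (convexHull ℝ (T : Set (Space d))) ∧
      ∀ x ∈ interior (convexHull ℝ (T : Set (Space d))),
        HasFDerivAt (K.hat z) (LinearMap.toContinuousLinearMap A.linear) x := by
  obtain ⟨A, hA0, hA⟩ := K.exists_hat_eqOn hT z
  refine ⟨A, hA0, hA, fun x hx => ?_⟩
  have h1 : HasFDerivAt (fun y => LinearMap.toContinuousLinearMap A.linear y + A 0)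
      (LinearMap.toContinuousLinearMap A.linear) x :=
    (LinearMap.toContinuousLinearMap A.linear).hasFDerivAt.add_const _
  refine h1.congr_of_eventuallyEq ?_
  filter_upwards [mem_interior_iff_mem_nhds.1 hx] with y hy
  rw [hA hy]
  simpa using A.map_vadd 0 y

theorem differentiableAt_hat {T : Finset (Space d)} (hT : T ∈ K.elements) (z : Space d)
    {x : Space d} (hx : x ∈ interior (convexHull ℝ (T : Set (Space d)))) :
    DifferentiableAt ℝ (K.hat z) x := by
  obtain ⟨A, -, -, h⟩ := K.exists_hasFDerivAt_hat hT z
  exact (h x hx).differentiableAt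

theorem dhat_eq_zero {T : Finset (Space d)} (hT : T ∈ K.elements) {z : Space d} (hz : z ∉ T)
    {x : Space d} (hx : x ∈ interior (convexHull ℝ (T : Set (Space d)))) (i : Fin d) :
    K.dhat z i x = 0 := by
  obtain ⟨A, hA0, -, h⟩ := K.exists_hasFDerivAt_hat hT z
  rw [dhat, (h x hx).fderiv, hA0 hz]
  simp

/-- The basis function is affine on the element with values in `[0, 1]`, so it changes by at most 1
along a segment of length `r` from the centre of the ball. -/
theorem abs_dhat_le {T : Finset (Space d)} (hT : T ∈ K.elements) {r : ℝ} (hr : 0 < r)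
    {c : Space d} (hc : Metric.closedBall c r ⊆ convexHull ℝ (T : Set (Space d))) (z : Space d)
    {x : Space d} (hx : x ∈ interior (convexHull ℝ (T : Set (Space d)))) (i : Fin d) :
    |K.dhat z i x| ≤ 1 / r := by
  obtain ⟨A, -, hA, h⟩ := K.exists_hasFDerivAt_hat hT z
  rw [dhat, (h x hx).fderiv]
  set e : Space d := EuclideanSpace.single i 1 with he
  have h0 : c ∈ convexHull ℝ (T : Set (Space d)) := hc (Metric.mem_closedBall_self hr.le)
  have h1 : r • e + c ∈ convexHull ℝ (T : Set (Space d)) := by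
    apply hc
    rw [Metric.mem_closedBall, dist_eq_norm, add_sub_cancel_right, norm_smul, he]
    simp [abs_of_pos hr]
  have h2 : r * A.linear e = K.hat z (r • e + c) - K.hat z c := by
    have := A.map_vadd c (r • e)
    simp only [vadd_eq_add, map_smul, smul_eq_mul] at this
    rw [hA h0, hA h1, this]; ring
  have h3 : |r * A.linear e| ≤ 1 := by
    rw [h2, abs_le]
    constructor <;> linarith [K.hat_nonneg z c, K.hat_nonneg z (r • e + c), K.hat_le_one z c,
      K.hat_le_one z (r • e + c)]
  rw [abs_mul, abs_of_pos hr] at h3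
  rw [le_div_iff₀ hr, mul_comm]
  exact h3

/-- Every element contains a ball of radius `r`. -/
def HasInballs (r : ℝ) : Prop :=
  ∀ T ∈ K.elements, ∃ x : Space d, Metric.closedBall x r ⊆ convexHull ℝ (T : Set (Space d))

theorem integrable_hat (hΩ : IsPolyhedralDomain Ω) (z : Space d) :
    IntegrableOn (K.hat z) Ω := by
  refine IntegrableOn.of_bound hΩ.isBounded.measure_lt_top
    (((K.continuousOn_hat z).mono subset_closure).aestronglyMeasurable hΩ.isOpen.measurableSet) 1
    (Filter.Eventually.of_forall fun x => ?_)
  rw [Real.norm_eq_abs, abs_of_nonneg (K.hat_nonneg z x)]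
  exact K.hat_le_one z x

theorem discInner_eq (hΩ : IsPolyhedralDomain Ω) (v w : Space d → R3) :
    K.discInner v w = ∑ z ∈ K.nodes, ⟪v z, w z⟫_ℝ * K.beta z := by
  simp only [discInner, interp, beta]
  rw [integral_finsetSum _ fun z _ => (K.integrable_hat hΩ z).const_mul _]
  simp only [integral_const_mul]

/-- The entries of the stiffness matrix. -/
noncomputable def stiff (z z' : Space d) : ℝ :=
  ∫ x in Ω, ∑ i : Fin d, K.dhat z i x * K.dhat z' i x

variable {K} in
theorem HasInballs.ae_abs_dhat_le {r : ℝ} (hK : K.HasInballs r) (hΩ : IsPolyhedralDomain Ω)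
    (hr : 0 < r) (z : Space d) (i : Fin d) :
    ∀ᵐ x ∂volume.restrict Ω, |K.dhat z i x| ≤ 1 / r := by
  filter_upwards [K.ae_mem_interior hΩ] with x ⟨T, hT, hx⟩
  obtain ⟨c, hc⟩ := hK T hT
  exact K.abs_dhat_le hT hr hc z hx i

variable {K} in
theorem HasInballs.integrable_dhat_mul {r : ℝ} (hK : K.HasInballs r) (hΩ : IsPolyhedralDomain Ω)
    (hr : 0 < r) (z z' : Space d) (i : Fin d) :
    IntegrableOn (fun x => K.dhat z i x * K.dhat z' i x) Ω := by
  refine IntegrableOn.of_bound hΩ.isBounded.measure_lt_top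
    ((K.measurable_dhat z i).mul (K.measurable_dhat z' i)).aestronglyMeasurable
    (1 / r * (1 / r)) ?_
  filter_upwards [hK.ae_abs_dhat_le hΩ hr z i, hK.ae_abs_dhat_le hΩ hr z' i] with x h1 h2
  rw [norm_mul]
  exact mul_le_mul h1 h2 (norm_nonneg _) (by positivity)

variable {K} in
theorem HasInballs.integrable_sum_dhat_mul {r : ℝ} (hK : K.HasInballs r)
    (hΩ : IsPolyhedralDomain Ω) (hr : 0 < r) (z z' : Space d) :
    IntegrableOn (fun x => ∑ i, K.dhat z i x * K.dhat z' i x) Ω :=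
  integrable_finsetSum _ fun i _ => hK.integrable_dhat_mul hΩ hr z z' i

theorem fderiv_feSpace {v : Space d → R3} (hv : v ∈ K.feSpace R3)
    {T : Finset (Space d)} (hT : T ∈ K.elements) {x : Space d}
    (hx : x ∈ interior (convexHull ℝ (T : Set (Space d)))) (i : Fin d) :
    fderiv ℝ v x (EuclideanSpace.single i 1) = ∑ z ∈ K.nodes, K.dhat z i x • v z := by
  have h : HasFDerivAt (fun x => ∑ z ∈ K.nodes, K.hat z x • v z)
      (∑ z ∈ K.nodes, (fderiv ℝ (K.hat z) x).smulRight (v z)) x :=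
    HasFDerivAt.fun_sum fun z _ =>
      (K.differentiableAt_hat hT z hx).hasFDerivAt.smul_const (v z)
  rw [← K.eq_sum_hat hv] at h
  rw [h.fderiv]
  simp [dhat]

variable {K} in
theorem HasInballs.gradInner_eq {r : ℝ} (hK : K.HasInballs r) (hΩ : IsPolyhedralDomain Ω)
    (hr : 0 < r) {v w : Space d → R3} (hv : v ∈ K.feSpace R3) (hw : w ∈ K.feSpace R3) :
    gradInner Ω v w =
      ∑ z ∈ K.nodes, ∑ z' ∈ K.nodes, K.stiff z z' * ⟪v z, w z'⟫_ℝ := by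
  have h : ∀ᵐ x ∂volume.restrict Ω,
      ∑ i : Fin d, ⟪fderiv ℝ v x (EuclideanSpace.single i 1),
        fderiv ℝ w x (EuclideanSpace.single i 1)⟫_ℝ =
      ∑ z ∈ K.nodes, ∑ z' ∈ K.nodes,
        (∑ i, K.dhat z i x * K.dhat z' i x) * ⟪v z, w z'⟫_ℝ := by
    filter_upwards [K.ae_mem_interior hΩ] with x ⟨T, hT, hx⟩
    simp only [K.fderiv_feSpace hv hT hx, K.fderiv_feSpace hw hT hx, sum_inner, inner_sum,
      real_inner_smul_left, real_inner_smul_right, Finset.sum_mul]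
    conv_rhs => rw [Finset.sum_comm]
    rw [Finset.sum_comm]
    refine Finset.sum_congr rfl fun z _ => ?_
    rw [Finset.sum_comm]
    exact Finset.sum_congr rfl fun z' _ => Finset.sum_congr rfl fun i _ => by ring
  rw [gradInner, integral_congr_ae h, integral_finsetSum]
  · refine Finset.sum_congr rfl fun z _ => ?_
    rw [integral_finsetSum]
    · simp only [stiff, integral_mul_const]
    · exact fun z' _ => (hK.integrable_sum_dhat_mul hΩ hr z z').mul_const _
  · exact fun z _ => integrable_finsetSum _ fun z' _ =>
      (hK.integrable_sum_dhat_mul hΩ hr z z').mul_const _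

theorem stiff_comm (z z' : Space d) : K.stiff z z' = K.stiff z' z := by
  simp only [stiff, mul_comm]

/-! ### Nodal stars and the inverse estimate -/

/-- The union of the elements that contain the node `z`. -/
def star (z : Space d) : Set (Space d) :=
  ⋃ T ∈ {T ∈ K.elements | z ∈ T}, convexHull ℝ (T : Set (Space d))

theorem mem_star {z x : Space d} :
    x ∈ K.star z ↔ ∃ T ∈ K.elements, z ∈ T ∧ x ∈ convexHull ℝ (T : Set (Space d)) := by
  simp [star, and_assoc]

theorem isClosed_star (z : Space d) : IsClosed (K.star z) :=
  (K.finite_elements.subset fun _ h => h.1).isClosed_biUnion fun T _ => isClosed_hull T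

theorem star_subset (z : Space d) : K.star z ⊆ closure Ω :=
  Set.iUnion₂_subset fun _ hT => K.convexHull_subset_closure hT.1

theorem volume_star_ne_top (hΩ : IsPolyhedralDomain Ω) (z : Space d) :
    volume (K.star z) ≠ ⊤ :=
  ((hΩ.isBounded.closure.subset (K.star_subset z)).measure_lt_top).ne

theorem homothety_star {z x : Space d} (hx : x ∈ K.star z) :
    AffineMap.homothety z (1 / 2 : ℝ) x ∈ K.star z ∧
      1 / 2 ≤ K.hat z (AffineMap.homothety z (1 / 2 : ℝ) x) := by
  classical
  obtain ⟨T, hT, hzT, hx⟩ := K.mem_star.1 hx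
  have hz : z ∈ convexHull ℝ (T : Set (Space d)) :=
    subset_convexHull ℝ _ (by exact_mod_cast hzT)
  have hm : AffineMap.homothety z (1 / 2 : ℝ) x ∈ convexHull ℝ (T : Set (Space d)) := by
    rw [AffineMap.homothety_eq_lineMap]
    exact (convex_convexHull ℝ _).lineMap_mem hz hx ⟨by norm_num, by norm_num⟩
  refine ⟨K.mem_star.2 ⟨T, hT, hzT, hm⟩, ?_⟩
  obtain ⟨A, -, hA⟩ := K.exists_hat_eqOn hT z
  have h1 : A z = 1 := by
    rw [← hA hz, K.hat_node (K.mem_nodes_of_mem_face hT.1 hzT), if_pos rfl]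
  have h2 : 0 ≤ A x := by rw [← hA hx]; exact K.hat_nonneg z x
  rw [hA hm, AffineMap.homothety_eq_lineMap, AffineMap.apply_lineMap, h1,
    AffineMap.lineMap_apply_ring']
  linarith

/-- Shrinking the star by 1/2 towards `z` keeps it in itself and multiplies its volume by `2⁻ᵈ`. On
the image the basis function is at least 1/2, which supplies the last factor 2. -/
theorem volume_star_le_beta (hΩ : IsPolyhedralDomain Ω) (z : Space d) :
    volume.real (K.star z) ≤ 2 ^ (d + 1) * K.beta z := by
  set H : Set (Space d) := AffineMap.homothety z (1 / 2 : ℝ) '' K.star z with hH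
  have hHs : H ⊆ K.star z := by
    rintro _ ⟨x, hx, rfl⟩; exact (K.homothety_star hx).1
  have hHΩ : H ⊆ closure Ω := hHs.trans (K.star_subset z)
  have hHv : volume.real H = (1 / 2) ^ d * volume.real (K.star z) := by
    rw [measureReal_def, hH, Measure.addHaar_image_homothety, ENNReal.toReal_mul,
      ENNReal.toReal_ofReal (abs_nonneg _), finrank_euclideanSpace_fin, measureReal_def,
      abs_of_nonneg (by positivity)]
  have hHc : MeasurableSet H := by
    refine IsClosed.measurableSet ?_
    have : IsCompact (K.star z) :=
      Metric.isCompact_of_isClosed_isBounded (K.isClosed_star z)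
        (hΩ.isBounded.closure.subset (K.star_subset z))
    exact (this.image (AffineMap.homothety z (1 / 2 : ℝ)).continuous_of_finiteDimensional).isClosed
  have hfin : volume H ≠ ⊤ := ne_top_of_le_ne_top (K.volume_star_ne_top hΩ z) (measure_mono hHs)
  have hint : IntegrableOn (K.hat z) (closure Ω) := by
    rw [IntegrableOn, K.restrict_closure_eq hΩ]; exact K.integrable_hat hΩ z
  have h1 : ∫ x in H, (1 / 2 : ℝ) ≤ ∫ x in H, K.hat z x := by
    refine setIntegral_mono_on (integrableOn_const hfin) (hint.mono_set hHΩ) hHc ?_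
    rintro _ ⟨x, hx, rfl⟩; exact (K.homothety_star hx).2
  have h2 : ∫ x in H, K.hat z x ≤ K.beta z := by
    rw [beta, ← K.restrict_closure_eq hΩ]
    exact setIntegral_mono_set hint (Filter.Eventually.of_forall fun x => K.hat_nonneg z x)
      hHΩ.eventuallyLE
  rw [setIntegral_const, hHv, smul_eq_mul] at h1
  have h3 := h1.trans h2
  calc volume.real (K.star z)
      = 2 ^ (d + 1) * ((1 / 2) ^ d * volume.real (K.star z) * (1 / 2)) := by
        rw [pow_succ, one_div, inv_pow]; field_simp
    _ ≤ _ := by gcongr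

variable {K} in
theorem HasInballs.beta_pos {r : ℝ} (hK : K.HasInballs r) (hΩ : IsPolyhedralDomain Ω)
    (hr : 0 < r) {z : Space d} (hz : z ∈ K.nodes) : 0 < K.beta z := by
  obtain ⟨T, hT, hzT⟩ := K.exists_element hz
  obtain ⟨c, hc⟩ := hK T hT
  have h1 : 0 < volume (K.star z) := by
    refine (Metric.measure_ball_pos volume c hr).trans_le (measure_mono ?_)
    exact (Metric.ball_subset_closedBall.trans hc).trans
      fun x hx => K.mem_star.2 ⟨T, hT, hzT, hx⟩
  have h2 : 0 < volume.real (K.star z) :=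
    ENNReal.toReal_pos h1.ne' (K.volume_star_ne_top hΩ z)
  have h3 := h2.trans_le (K.volume_star_le_beta hΩ z)
  exact pos_of_mul_pos_right h3 (by positivity)

/-- Only the `d + 1` vertices of the element contribute, each through `d` products bounded by `1 / r
^ 2`. The bound is thus independent of the number of nodes. -/
theorem sum_abs_dhat_mul_le {T : Finset (Space d)} (hT : T ∈ K.elements) {r : ℝ} (hr : 0 < r)
    {c : Space d} (hc : Metric.closedBall c r ⊆ convexHull ℝ (T : Set (Space d))) (z : Space d)
    {x : Space d} (hx : x ∈ interior (convexHull ℝ (T : Set (Space d)))) :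
    ∑ z' ∈ K.nodes, |∑ i, K.dhat z i x * K.dhat z' i x| ≤ (d + 1) * d / r ^ 2 := by
  rw [← Finset.sum_subset (fun y hy => K.mem_nodes_of_mem_face hT.1 hy)
      (fun y _ hy => by simp [K.dhat_eq_zero hT hy hx])]
  have h : ∀ z' ∈ T, |∑ i, K.dhat z i x * K.dhat z' i x| ≤ d * (1 / r * (1 / r)) := by
    intro z' _
    refine (Finset.abs_sum_le_sum_abs _ _).trans ?_
    refine (Finset.sum_le_card_nsmul _ _ (1 / r * (1 / r)) fun i _ => ?_).trans (by simp)
    rw [abs_mul]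
    exact mul_le_mul (K.abs_dhat_le hT hr hc z hx i) (K.abs_dhat_le hT hr hc z' hx i)
      (abs_nonneg _) (by positivity)
  refine (Finset.sum_le_card_nsmul _ _ _ h).trans (le_of_eq ?_)
  rw [hT.2, nsmul_eq_mul]
  push_cast
  field_simp

variable {K} in
/-- The inverse estimate for the discrete Laplacian in the maximum norm. -/
theorem HasInballs.sum_abs_stiff_le {r : ℝ} (hK : K.HasInballs r) (hΩ : IsPolyhedralDomain Ω)
    (hr : 0 < r) (z : Space d) :
    ∑ z' ∈ K.nodes, |K.stiff z z'| ≤ (d + 1) * d / r ^ 2 * 2 ^ (d + 1) * K.beta z := by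
  set c : ℝ := (d + 1) * d / r ^ 2 with hc
  have hc0 : 0 ≤ c := by positivity
  have h1 : ∑ z' ∈ K.nodes, |K.stiff z z'| ≤
      ∫ x in Ω, ∑ z' ∈ K.nodes, |∑ i, K.dhat z i x * K.dhat z' i x| := by
    rw [integral_finsetSum _ fun z' _ => (hK.integrable_sum_dhat_mul hΩ hr z z').abs]
    exact Finset.sum_le_sum fun z' _ => abs_integral_le_integral_abs
  have hms : MeasurableSet (K.star z) := (K.isClosed_star z).measurableSet
  have h2 : ∫ x in Ω, ∑ z' ∈ K.nodes, |∑ i, K.dhat z i x * K.dhat z' i x| ≤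
      ∫ x in Ω, (K.star z).indicator (fun _ => c) x := by
    have : IsFiniteMeasure (volume.restrict Ω) := ⟨by
      rw [Measure.restrict_apply_univ]; exact hΩ.isBounded.measure_lt_top⟩
    refine integral_mono_ae
      (integrable_finsetSum _ fun z' _ => (hK.integrable_sum_dhat_mul hΩ hr z z').abs)
      ((integrable_const c).indicator hms) ?_
    filter_upwards [K.ae_mem_interior hΩ] with x ⟨T, hT, hx⟩
    by_cases hz : z ∈ T
    · rw [Set.indicator_of_mem (K.mem_star.2 ⟨T, hT, hz, interior_subset hx⟩)]
      obtain ⟨y, hy⟩ := hK T hT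
      exact K.sum_abs_dhat_mul_le hT hr hy z hx
    · refine le_trans (le_of_eq ?_) (Set.indicator_nonneg (fun _ _ => hc0) x)
      exact Finset.sum_eq_zero fun z' _ => by simp [K.dhat_eq_zero hT hz hx]
  have h3 : ∫ x in Ω, (K.star z).indicator (fun _ => c) x ≤ volume.real (K.star z) * c := by
    rw [integral_indicator_const c hms, smul_eq_mul]
    refine mul_le_mul_of_nonneg_right ?_ hc0
    exact ENNReal.toReal_mono (K.volume_star_ne_top hΩ z) (Measure.restrict_apply_le _ _)
  calc _ ≤ volume.real (K.star z) * c := h1.trans (h2.trans h3)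
    _ ≤ 2 ^ (d + 1) * K.beta z * c :=
        mul_le_mul_of_nonneg_right (K.volume_star_le_beta hΩ z) hc0
    _ = _ := by ring

end Triangulation

/-! ### Projection onto a line, the fixed point and the multiplier -/

section Abstract

variable {E : Type} [NormedAddCommGroup E] [InnerProductSpace ℝ E]

/-- The orthogonal projection of `a` onto the line spanned by `q`. -/
noncomputable def lineProj (a q : E) : E := (⟪a, q⟫_ℝ / ‖q‖ ^ 2) • q

theorem norm_lineProj_le (a q : E) : ‖lineProj a q‖ ≤ ‖a‖ := by
  rcases eq_or_ne q 0 with rfl | hq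
  · simp [lineProj]
  have hq' : 0 < ‖q‖ := norm_pos_iff.2 hq
  rw [lineProj, norm_smul, norm_div, norm_pow, norm_norm, div_mul_eq_mul_div,
    div_le_iff₀ (by positivity)]
  calc ‖⟪a, q⟫_ℝ‖ * ‖q‖ ≤ ‖a‖ * ‖q‖ * ‖q‖ := by gcongr; exact norm_inner_le_norm a q
    _ = ‖a‖ * ‖q‖ ^ 2 := by ring

theorem norm_lineProj_sub_le {a q q' : E} (hq : 1 ≤ ‖q‖) (hq' : 1 ≤ ‖q'‖) :
    ‖lineProj a q - lineProj a q'‖ ≤ 2 * ‖a‖ * ‖q - q'‖ := by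
  have h0 : q ≠ 0 := norm_pos_iff.1 (by linarith)
  have h0' : q' ≠ 0 := norm_pos_iff.1 (by linarith)
  have hd := dist_div_norm_sq_smul h0 h0' 1
  rw [dist_eq_norm, dist_eq_norm] at hd
  -- The projection is a pairing times the inversion `q / ‖q‖ ^ 2`. Varying the two factors
  -- separately costs `‖a‖ * ‖q - q'‖` each; inversion contributes the factor `1 / (‖q‖ * ‖q'‖)`.
  have e : lineProj a q - lineProj a q' =
      (⟪a, q - q'⟫_ℝ / ‖q‖ ^ 2) • q +
        ⟪a, q'⟫_ℝ • ((1 / ‖q‖) ^ 2 • q - (1 / ‖q'‖) ^ 2 • q') := by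
    rw [lineProj, lineProj, inner_sub_right]
    module
  have h1 : ‖(⟪a, q - q'⟫_ℝ / ‖q‖ ^ 2) • q‖ ≤ ‖a‖ * ‖q - q'‖ := by
    rw [norm_smul, norm_div, norm_pow, norm_norm, div_mul_eq_mul_div,
      div_le_iff₀ (by positivity)]
    calc ‖⟪a, q - q'⟫_ℝ‖ * ‖q‖ ≤ ‖a‖ * ‖q - q'‖ * ‖q‖ := by
          gcongr; exact norm_inner_le_norm a _
      _ ≤ ‖a‖ * ‖q - q'‖ * ‖q‖ ^ 2 := by gcongr; nlinarith
  have h2 : ‖⟪a, q'⟫_ℝ • ((1 / ‖q‖) ^ 2 • q - (1 / ‖q'‖) ^ 2 • q')‖ ≤ ‖a‖ * ‖q - q'‖ := by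
    rw [norm_smul, hd]
    calc ‖⟪a, q'⟫_ℝ‖ * (1 ^ 2 / (‖q‖ * ‖q'‖) * ‖q - q'‖)
        ≤ ‖a‖ * ‖q'‖ * (1 ^ 2 / (‖q‖ * ‖q'‖) * ‖q - q'‖) := by
          gcongr; exact norm_inner_le_norm a _
      _ = ‖a‖ * ‖q - q'‖ / ‖q‖ := by field_simp
      _ ≤ ‖a‖ * ‖q - q'‖ := div_le_self (by positivity) hq
  rw [e]
  refine (norm_add_le _ _).trans ?_
  linarith

/-- Nodewise projection onto the lines spanned by a small linear perturbation of `p` has a fixed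
point. -/
theorem exists_lineProj_fixedPoint [CompleteSpace E] {ι : Type*} [Fintype ι]
    (G : (ι → E) →ₗ[ℝ] (ι → E)) (hG : ∀ u, ‖G u‖ ≤ 1 / 4 * ‖u‖) (U p : ι → E)
    (hU : ∀ z, ‖U z‖ = 1) (hp : ∀ z, 2 ≤ ⟪U z, p z⟫_ℝ) :
    ∃ u : ι → E, ∀ z, 0 < ⟪U z, p z - G u z⟫_ℝ ∧ u z = lineProj (U z) (p z - G u z) := by
  set f : (ι → E) → (ι → E) := fun u z => lineProj (U z) (p z - G u z) with hf
  -- The perturbation is at most 1/4, so the margin 2 drops to no less than 7/4.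
  have hball : ∀ u ∈ Metric.closedBall (0 : ι → E) 1, ∀ z, 1 ≤ ⟪U z, p z - G u z⟫_ℝ := by
    intro u hu z
    rw [mem_closedBall_zero_iff] at hu
    have h1 : ‖G u z‖ ≤ 1 / 4 := (norm_le_pi_norm (G u) z).trans ((hG u).trans (by linarith))
    have h2 := real_inner_le_norm (U z) (G u z)
    rw [hU z, one_mul] at h2
    rw [inner_sub_right]
    linarith [hp z]
  have hnorm : ∀ u ∈ Metric.closedBall (0 : ι → E) 1, ∀ z, 1 ≤ ‖p z - G u z‖ := by
    intro u hu z
    have h2 := real_inner_le_norm (U z) (p z - G u z)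
    rw [hU z, one_mul] at h2
    exact (hball u hu z).trans h2
  have hmaps : Set.MapsTo f (Metric.closedBall 0 1) (Metric.closedBall 0 1) := by
    intro u _
    rw [mem_closedBall_zero_iff, pi_norm_le_iff_of_nonneg zero_le_one]
    exact fun z => (norm_lineProj_le _ _).trans (hU z).le
  have hlip : LipschitzWith (1 / 2) (hmaps.restrict f _ _) := by
    refine LipschitzWith.of_dist_le_mul fun u v => ?_
    rw [Subtype.dist_eq, Subtype.dist_eq, dist_eq_norm, dist_eq_norm,
      pi_norm_le_iff_of_nonneg (by positivity)]
    intro z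
    refine (norm_lineProj_sub_le (hnorm u u.2 z) (hnorm v v.2 z)).trans ?_
    have h1 : (p z - G u z) - (p z - G v z) = G (v.1 - u.1) z := by
      rw [map_sub, Pi.sub_apply]; abel
    have h2 : ‖G (v.1 - u.1) z‖ ≤ 1 / 4 * ‖u.1 - v.1‖ := by
      rw [norm_sub_rev u.1]
      exact (norm_le_pi_norm _ z).trans (hG _)
    rw [h1, hU z]
    push_cast
    linarith
  obtain ⟨u, hu, hfu, -⟩ := ContractingWith.exists_fixedPoint'
    Metric.isClosed_closedBall.isComplete hmaps ⟨by norm_num, hlip⟩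
    (Metric.mem_closedBall_self zero_le_one) (edist_ne_top _ _)
  exact ⟨u, fun z => ⟨by linarith [hball u hu z], (congrFun hfu z).symm⟩⟩

/-- If the average `u` is the projection of the unit vector `U` to the line spanned by
`3 U - Uprev - τ² g`, then the residual is the multiple of `u` given by the discrete Lagrange
multiplier. -/
theorem residual_eq_smul {τ : ℝ} (hτ : τ ≠ 0) {U Uprev g u : E} {m : ℝ}
    (hq : 0 < ⟪U, (3 : ℝ) • U - Uprev - τ ^ 2 • g⟫_ℝ)
    (hu : u = lineProj U ((3 : ℝ) • U - Uprev - τ ^ 2 • g))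
    (hm : ⟪u, u⟫_ℝ = ⟪U, u⟫_ℝ → τ ^ 2 * m = ⟪U, u⟫_ℝ - ⟪Uprev, u⟫_ℝ) :
    u ≠ 0 ∧ dt τ (dt τ Uprev U) (dt τ U ((2 : ℝ) • u - U)) + g =
      (-m / ‖u‖ ^ 2 + ⟪g, u⟫_ℝ / ‖u‖ ^ 2) • u := by
  set q := (3 : ℝ) • U - Uprev - τ ^ 2 • g with hqdef
  have hq0 : q ≠ 0 := by rintro h; rw [h, inner_zero_right] at hq; exact hq.false
  have hqn : 0 < ‖q‖ ^ 2 := by positivity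
  have hu0 : u ≠ 0 := by
    rw [hu, lineProj]
    exact smul_ne_zero (div_pos hq hqn).ne' hq0
  have hun : ‖u‖ ^ 2 ≠ 0 := by positivity
  have hqu : q = (‖q‖ ^ 2 / ⟪U, q⟫_ℝ) • u := by
    rw [hu, lineProj, smul_smul, div_mul_div_cancel₀ hq.ne', div_self hqn.ne', one_smul]
  set s := ‖q‖ ^ 2 / ⟪U, q⟫_ℝ
  -- Equivalent to `‖2 • u - U‖ = ‖U‖`: the new value is the reflection of `U` in the line of `q`.
  have huu : ⟪u, u⟫_ℝ = ⟪U, u⟫_ℝ := by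
    rw [hu, lineProj, real_inner_smul_left, real_inner_smul_right, real_inner_smul_right,
      real_inner_self_eq_norm_sq]
    field_simp
  have hres : dt τ (dt τ Uprev U) (dt τ U ((2 : ℝ) • u - U)) + g = ((2 - s) / τ ^ 2) • u := by
    have h1 : dt τ (dt τ Uprev U) (dt τ U ((2 : ℝ) • u - U)) + g =
        (τ ^ 2)⁻¹ • ((2 : ℝ) • u - q) := by
      rw [hqdef, smul_sub _ _ (_ - τ ^ 2 • g), smul_sub _ _ (τ ^ 2 • g), smul_smul _ _ g,
        inv_mul_cancel₀ (by positivity)]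
      simp only [dt]
      rw [← inv_pow]
      module
    rw [h1]
    conv_lhs => rw [hqu]
    module
  have hg : τ ^ 2 • g = (3 : ℝ) • U - Uprev - s • u := by
    rw [← hqu, hqdef]; abel
  have hgu : τ ^ 2 * ⟪g, u⟫_ℝ = 3 * ⟪U, u⟫_ℝ - ⟪Uprev, u⟫_ℝ - s * ⟪u, u⟫_ℝ := by
    rw [← real_inner_smul_left, hg, inner_sub_left, inner_sub_left, real_inner_smul_left,
      real_inner_smul_left]
  refine ⟨hu0, ?_⟩
  rw [hres]
  congr 1
  rw [← add_div, div_eq_div_iff (by positivity) hun, ← real_inner_self_eq_norm_sq]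
  have := hm huu
  -- Both sides, multiplied by `τ ^ 2`, equal `2⟪U, u⟫ - s⟪u, u⟫`.
  linear_combination this - hgu + 2 * huu

end Abstract

/-! ### The time step in nodal values -/

namespace Triangulation

variable {d : ℕ} {Ω : Set (Space d)} (K : Triangulation Ω)

/-- The nodal values of the discrete (negative) Laplacian. -/
noncomputable def lap : (K.nodes → R3) →ₗ[ℝ] (K.nodes → R3) where
  toFun u z := (K.beta z)⁻¹ • ∑ y : K.nodes, K.stiff z y • u y
  map_add' u v := by
    funext z; simp [smul_add, Finset.sum_add_distrib]
  map_smul' c u := by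
    funext z; simp only [Pi.smul_apply, smul_comm _ c, ← Finset.smul_sum, RingHom.id_apply]

theorem lap_apply (u : K.nodes → R3) (z : K.nodes) :
    K.lap u z = (K.beta z)⁻¹ • ∑ y : K.nodes, K.stiff z y • u y := rfl

variable {K}

/-- In the maximum norm the operator is controlled by absolute row sums; the lumped weight `K.beta
z` cancels against the one in the inverse estimate. -/
theorem HasInballs.norm_lap_le {r : ℝ} (hK : K.HasInballs r) (hΩ : IsPolyhedralDomain Ω)
    (hr : 0 < r) (u : K.nodes → R3) :
    ‖K.lap u‖ ≤ (d + 1) * d / r ^ 2 * 2 ^ (d + 1) * ‖u‖ := by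
  rw [pi_norm_le_iff_of_nonneg (by positivity)]
  intro z
  have hb := hK.beta_pos hΩ hr z.2
  rw [lap_apply, norm_smul, norm_inv, Real.norm_of_nonneg hb.le, inv_mul_le_iff₀ hb]
  calc ‖∑ y : K.nodes, K.stiff z y • u y‖
      ≤ ∑ y : K.nodes, |K.stiff z y| * ‖u‖ := by
        refine norm_sum_le_of_le _ fun y _ => ?_
        rw [norm_smul, Real.norm_eq_abs]
        exact mul_le_mul_of_nonneg_left (norm_le_pi_norm u y) (abs_nonneg _)
    _ = (∑ y ∈ K.nodes, |K.stiff z y|) * ‖u‖ := by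
        rw [← Finset.sum_mul, Finset.sum_coe_sort K.nodes (fun y => |K.stiff z y|)]
    _ ≤ (d + 1) * d / r ^ 2 * 2 ^ (d + 1) * K.beta z * ‖u‖ := by
        gcongr
        exact hK.sum_abs_stiff_le hΩ hr z
    _ = _ := by ring

theorem HasInballs.gradInner_eq_sum_lap {r : ℝ} (hK : K.HasInballs r)
    (hΩ : IsPolyhedralDomain Ω) (hr : 0 < r) {v w : Space d → R3} (hv : v ∈ K.feSpace R3)
    (hw : w ∈ K.feSpace R3) :
    gradInner Ω v w = ∑ z : K.nodes, ⟪K.lap (fun y => v y) z, w z⟫_ℝ * K.beta z := by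
  rw [hK.gradInner_eq hΩ hr hv hw, Finset.sum_comm, ← Finset.sum_coe_sort K.nodes]
  refine Finset.sum_congr rfl fun z _ => ?_
  have hb := hK.beta_pos hΩ hr z.2
  rw [lap_apply, real_inner_smul_left, mul_comm, mul_inv_cancel_left₀ hb.ne', sum_inner,
    ← Finset.sum_coe_sort K.nodes]
  exact Finset.sum_congr rfl fun y _ => by rw [real_inner_smul_left, K.stiff_comm]

theorem HasInballs.gradInner_hat_smul {r : ℝ} (hK : K.HasInballs r)
    (hΩ : IsPolyhedralDomain Ω) (hr : 0 < r) {v : Space d → R3} (hv : v ∈ K.feSpace R3)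
    (z : K.nodes) (e : R3) :
    gradInner Ω v (fun x => K.hat z x • e) = ⟪K.lap (fun y => v y) z, e⟫_ℝ * K.beta z := by
  classical
  rw [hK.gradInner_eq_sum_lap hΩ hr hv (K.hat_smul_mem_feSpace _ e),
    Finset.sum_eq_single z]
  · rw [K.hat_node z.2, if_pos rfl, one_smul]
  · intro y _ hy
    rw [K.hat_node y.2, if_neg fun h => hy (Subtype.ext h.symm), zero_smul, inner_zero_right,
      zero_mul]
  · exact fun h => absurd (Finset.mem_univ z) h

theorem exists_feSpace_of_nodal_values (g : K.nodes → R3) :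
    ∃ v ∈ K.feSpace R3, ∀ z : K.nodes, v z = g z := by
  classical
  refine ⟨K.nodal fun x => if h : x ∈ K.nodes then g ⟨x, h⟩ else 0, K.nodal_mem _, fun z => ?_⟩
  rw [K.nodal_node _ z.2, dif_pos z.2]

theorem avg_two_smul_sub {X : Type} [AddCommGroup X] [Module ℝ X] (a u : X) :
    avg a ((2 : ℝ) • u - a) = u := by
  rw [avg, sub_add_cancel, smul_smul]; norm_num

/-- The value is `3 - ⟪U z, Uprev z⟫`. The inner product equals 1 for `n = 0` by orthogonality and
is at most 1 otherwise by Cauchy–Schwarz. -/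
theorem AdmissibleData.two_le_inner {n : ℕ} {τ : ℝ} {Uprev U : Space d → R3}
    (h : K.AdmissibleData n τ Uprev U) {z : Space d} (hz : z ∈ K.nodes) :
    2 ≤ ⟪U z, (3 : ℝ) • U z - Uprev z⟫_ℝ := by
  have h1 : ⟪U z, U z⟫_ℝ = 1 := by rw [real_inner_self_eq_norm_sq, h.norm_eq z hz, one_pow]
  rw [inner_sub_right, real_inner_smul_right, h1]
  by_cases hn : n = 0
  · obtain ⟨V, -, hV, rfl⟩ := h.initial hn
    rw [Pi.sub_apply, inner_sub_right, h1, Pi.smul_apply, real_inner_smul_right, hV z hz]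
    norm_num
  · have := real_inner_le_norm (U z) (Uprev z)
    rw [h.norm_eq z hz, h.norm_prev hn z hz] at this
    linarith

/-- The number `μ¹` in the definition of the multiplier, multiplied by `τ²`. -/
theorem AdmissibleData.sq_mul_initial {τ : ℝ} (hτ : τ ≠ 0) {Uprev U : Space d → R3}
    (h : K.AdmissibleData 0 τ Uprev U) {z : Space d} (hz : z ∈ K.nodes) (u : R3) :
    τ ^ 2 * (1 / 2 * ⟪dt τ (Uprev z) (U z), dt τ (U z) ((2 : ℝ) • u - U z)⟫_ℝ) =
      ⟪U z, u⟫_ℝ - ⟪Uprev z, u⟫_ℝ := by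
  have h1 : ⟪U z - Uprev z, U z⟫_ℝ = 0 := by
    obtain ⟨V, -, hV, rfl⟩ := h.initial rfl
    rw [Pi.sub_apply, sub_sub_cancel, Pi.smul_apply, real_inner_smul_left, real_inner_comm,
      hV z hz, mul_zero]
  -- This 2 cancels the factor 1/2 in μ¹, and `h1` removes the `U z` part of `u - U z`.
  have h2 : (2 : ℝ) • u - U z - U z = (2 : ℝ) • (u - U z) := by module
  rw [dt, dt, real_inner_smul_left, real_inner_smul_right, h2, real_inner_smul_right,
    inner_sub_right, h1, inner_sub_left]
  field_simp
  ring

/-- The number `μ^{n+1}`, `n ≥ 1`, in the definition of the multiplier, multiplied by `τ²`. -/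
theorem AdmissibleData.sq_mul_step {n : ℕ} (hn : n ≠ 0) {τ : ℝ} (hτ : τ ≠ 0)
    {Uprev U : Space d → R3} (h : K.AdmissibleData n τ Uprev U) {z : Space d}
    (hz : z ∈ K.nodes) (u : R3) :
    τ ^ 2 * ⟪dt τ (Uprev z) (U z), dt τ (avg (Uprev z) (U z)) u⟫_ℝ =
      ⟪U z, u⟫_ℝ - ⟪Uprev z, u⟫_ℝ := by
  have h1 : ⟪U z, U z⟫_ℝ = 1 := by rw [real_inner_self_eq_norm_sq, h.norm_eq z hz, one_pow]
  have h2 : ⟪Uprev z, Uprev z⟫_ℝ = 1 := by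
    rw [real_inner_self_eq_norm_sq, h.norm_prev hn z hz, one_pow]
  -- Equal lengths make difference and sum orthogonal, so the average at `n - 1/2` drops out of μ.
  have h3 : ⟪U z - Uprev z, U z + Uprev z⟫_ℝ = 0 := by
    rw [inner_sub_left, inner_add_right, inner_add_right, h1, h2, real_inner_comm]
    ring
  rw [dt, dt, avg, real_inner_smul_left, real_inner_smul_right, inner_sub_right,
    real_inner_smul_right, h3, inner_sub_left]
  field_simp
  ring

theorem HasInballs.multiplierValue_eq {r : ℝ} (hK : K.HasInballs r) (hΩ : IsPolyhedralDomain Ω)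
    (hr : 0 < r) {n : ℕ} {τ : ℝ} (hτ : τ ≠ 0) {Uprev U W u w : Space d → R3}
    (h : K.AdmissibleData n τ Uprev U) (hw : w ∈ K.feSpace R3) (z : K.nodes)
    (hq : 0 < ⟪U z, (3 : ℝ) • U z - Uprev z - τ ^ 2 • K.lap (fun y => w y) z⟫_ℝ)
    (hu : u z = lineProj (U z)
      ((3 : ℝ) • U z - Uprev z - τ ^ 2 • K.lap (fun y => w y) z)) :
    dt τ (dt τ (Uprev z) (U z)) (dt τ (U z) ((2 : ℝ) • u z - U z)) + K.lap (fun y => w y) z =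
      K.multiplierValue n τ Uprev U ((2 : ℝ) • u - U) W ((2 : ℝ) • w - W) z • u z := by
  have hb := hK.beta_pos hΩ hr z.2
  rw [multiplierValue]
  simp only [avg_two_smul_sub]
  rw [hK.gradInner_hat_smul hΩ hr hw, mul_comm (K.beta z), mul_div_mul_right _ _ hb.ne']
  by_cases hn : n = 0
  · subst hn
    obtain ⟨h0, h1⟩ := residual_eq_smul hτ hq hu fun _ => h.sq_mul_initial hτ z.2 (u z)
    -- The average does not vanish, so the default value 0 of the multiplier is never taken.
    rw [if_neg h0, if_pos rfl, h1]
    rfl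
  · obtain ⟨h0, h1⟩ := residual_eq_smul hτ hq hu fun _ => h.sq_mul_step hn hτ z.2 (u z)
    rw [if_neg h0, if_neg hn, h1]
    rfl

theorem HasInballs.exists_solvesStep {r : ℝ} (hK : K.HasInballs r) (hΩ : IsPolyhedralDomain Ω)
    (hr : 0 < r) {n : ℕ} {τ : ℝ} (hτ : 0 < τ)
    (hτr : τ * ((d + 1) * d / r ^ 2 * 2 ^ (d + 1)) ≤ 1 / 2) {Uprev U W : Space d → R3}
    (h : K.AdmissibleData n τ Uprev U) (hW : W ∈ K.feSpace R3) :
    ∃ Unext Wnext : Space d → R3, K.SolvesStep n τ Uprev U W Unext Wnext := by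
  have hG : ∀ u, ‖(τ ^ 2 • (K.lap ∘ₗ K.lap)) u‖ ≤ 1 / 4 * ‖u‖ := by
    intro u
    set c : ℝ := (d + 1) * d / r ^ 2 * 2 ^ (d + 1) with hc
    have hc0 : 0 ≤ c := by positivity
    rw [LinearMap.smul_apply, norm_smul, Real.norm_of_nonneg (by positivity)]
    calc τ ^ 2 * ‖K.lap (K.lap u)‖ ≤ τ ^ 2 * (c * (c * ‖u‖)) := by
          gcongr
          exact (hK.norm_lap_le hΩ hr _).trans
            (mul_le_mul_of_nonneg_left (hK.norm_lap_le hΩ hr u) hc0)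
      _ = (τ * c) ^ 2 * ‖u‖ := by ring
      _ ≤ (1 / 2) ^ 2 * ‖u‖ := by gcongr
      _ = 1 / 4 * ‖u‖ := by norm_num
  obtain ⟨g, hg⟩ := exists_lineProj_fixedPoint (τ ^ 2 • (K.lap ∘ₗ K.lap)) hG
    (fun z => U z) (fun z => (3 : ℝ) • U z - Uprev z) (fun z => h.norm_eq z z.2)
    (fun z => h.two_le_inner z.2)
  obtain ⟨u, hu, hug⟩ := exists_feSpace_of_nodal_values g
  obtain ⟨w, hw, hwg⟩ := exists_feSpace_of_nodal_values (K.lap g)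
  have hug' : (fun y : K.nodes => u y) = g := funext hug
  have hwg' : (fun y : K.nodes => w y) = K.lap g := funext hwg
  -- Only midpoints are solved for; `W` enters solely in recovering the new value from `w`, which is
  -- why it may be arbitrary.
  refine ⟨(2 : ℝ) • u - U, (2 : ℝ) • w - W, sub_mem (Submodule.smul_mem _ _ hu) h.mem,
    sub_mem (Submodule.smul_mem _ _ hw) hW, fun Φ hΦ => ?_, fun Ψ hΨ => ?_⟩
  · rw [avg_two_smul_sub, avg_two_smul_sub, K.discInner_eq hΩ, K.discInner_eq hΩ,
      hK.gradInner_eq_sum_lap hΩ hr hw hΦ, ← Finset.sum_coe_sort K.nodes,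
      ← Finset.sum_coe_sort K.nodes, ← Finset.sum_add_distrib]
    refine Finset.sum_congr rfl fun z _ => ?_
    have hz := hg z
    rw [LinearMap.smul_apply, LinearMap.comp_apply, ← hwg', Pi.smul_apply, ← hug] at hz
    have key := hK.multiplierValue_eq hΩ hr hτ.ne' (W := W) h hw z hz.1 hz.2
    rw [multiplier, K.interp_node _ z.2, ← key, ← add_mul, ← inner_add_left]
    rfl
  · rw [avg_two_smul_sub, avg_two_smul_sub, K.discInner_eq hΩ,
      hK.gradInner_eq_sum_lap hΩ hr hu hΨ, ← Finset.sum_coe_sort K.nodes, hug']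
    exact Finset.sum_congr rfl fun z _ => by rw [hwg]

theorem meshSize_nonneg (K : Triangulation Ω) : 0 ≤ K.meshSize :=
  Real.iSup_nonneg fun _ => Metric.diam_nonneg

end Triangulation

end BiharmonicWave

open BiharmonicWave in
theorem lemma3p2 (d : ℕ) (hd : 1 ≤ d) (hd3 : d ≤ 3) (κ : ℝ) (hκ : 0 < κ) :
    ∃ C : ℝ, 0 < C ∧
      ∀ (Ω : Set (Space d)), IsPolyhedralDomain Ω →
      ∀ K : Triangulation Ω, K.QuasiUniform κ →
      ∀ (n : ℕ) (τ : ℝ), 0 < τ → τ ≤ C * K.meshSize ^ 2 →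
      ∀ Uprev U W : Space d → R3, K.AdmissibleData n τ Uprev U → W ∈ K.feSpace R3 →
        ∃ Unext Wnext : Space d → R3, K.SolvesStep n τ Uprev U W Unext Wnext := by
  have hd0 : (0 : ℝ) < d := by exact_mod_cast hd
  have hc : (0 : ℝ) < (d + 1) * d * 2 ^ (d + 1) := by positivity
  -- Chosen so that τ times the bound for the discrete Laplacian with `r = κ h` is at most 1/2,
  -- whose square is the 1/4 of the contraction.
  refine ⟨κ ^ 2 / (2 * ((d + 1) * d * 2 ^ (d + 1))), by positivity, ?_⟩
  intro Ω hΩ K hK n τ hτ hτC Uprev U W hU hW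
  have hh : 0 < K.meshSize := by
    refine K.meshSize_nonneg.lt_of_ne' fun h => ?_
    rw [h] at hτC
    norm_num at hτC
    linarith
  have hr : 0 < κ * K.meshSize := mul_pos hκ hh
  refine Triangulation.HasInballs.exists_solvesStep (r := κ * K.meshSize) hK hΩ hr hτ ?_ hU hW
  rw [div_mul_eq_mul_div, mul_div_assoc', div_le_iff₀ (by positivity)]
  rw [div_mul_eq_mul_div, le_div_iff₀ (by positivity)] at hτC
  linarith
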